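/- Conventions. The Frobenius companion matrix of a monic polynomial $t^n+c_{n-1}t^{n-1}+\dots+c_0$ is the $n\times n$ matrix with ones directly below the diagonal, last column $(-c_0,\dots,-c_{n-1})^{T}$ and zeros elsewhere. The Kronecker sum of square matrices $A$ and $B$ of orders $r$ and $s$ is $A\boxplus B=A\otimes I_s+I_r\otimes B$. All roots $x^{1/k}$ of positive real numbers $x$ are the positive real ones. For positive integers $n,m$, positive integers $x_1,\dots,x_m$ and $z\in\mathbb C$, put $$p_n(z;x_1,\dots,x_m)=\prod_{s_1,\dots,s_m=1}^{n}\bigl(\sqrt[n]{z}+\epsilon^{s_1}\sqrt[n]{x_1}+\dots+\epsilon^{s_m}\sqrt[n]{x_m}\bigr),$$ where $\epsilon$ is a primitive $n$-th root of unity and $\sqrt[n]{\cdot}$ is the principal branch of the root. Theorem. Let $m\ge 1$. (1) Let $k_1,\dots,k_m$ be positive integers, and let $x_1,\dots,x_m$ be pairwise coprime positive integers. For each $j$ let $n_j$ be the smallest positive integer for which $a_j:=\bigl(x_j^{1/k_j}\bigr)^{n_j}$ is a positive integer. Let $F_j$ be the Frobenius companion matrix of $t^{n_j}-a_j$. Then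 the characteristic polynomial $$\det\bigl(zI-F_1\boxplus\dots\boxplus F_m\bigr)$$ in the variable $z$ is irreducible over $\mathbb Q$. (2) Let $n\ge 2$ be an integer, and let $x_1,\dots,x_m$ be pairwise coprime positive integers such that $(\sqrt[n]{x_j})^k$ is irrational for all integers $1\le k<n$ and all $j=1,\dots,m$. Then $p_n(z;x_1,\dots,x_m)$ is a polynomial in $z$ with integer coefficients, the same for every choice of $\epsilon$, and it is irreducible over $\mathbb Q$. -/

import Mathlib

open Polynomial
open scoped Kronecker

noncomputable section

/-- The Frobenius companion matrix `F(a_{n-1}, …, a_0)` of the monic polynomial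
`t ^ n + a_{n-1} t ^ (n-1) + ⋯ + a_0`: ones below the diagonal, and last column
`-a_0, …, -a_{n-1}`. -/
def frobeniusCompanion {R : Type*} [CommRing R] {n : ℕ} (a : Fin n → R) :
    Matrix (Fin n) (Fin n) R :=
  Matrix.of fun i j =>
    if (j : ℕ) + 1 = n then -a i else if (i : ℕ) = (j : ℕ) + 1 then 1 else 0

/-- The Frobenius companion matrix of the polynomial `t ^ n - a` (of degree `n ≥ 1`). -/
def radicalCompanion {R : Type*} [CommRing R] (n : ℕ) (a : R) : Matrix (Fin n) (Fin n) R :=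
  frobeniusCompanion fun i : Fin n => (X ^ n - C a : R[X]).coeff i

/-- The Kronecker sum `A ⊞ B = A ⊗ I + I ⊗ B`. -/
def kroneckerSum {R ι κ : Type*} [CommRing R] [DecidableEq ι] [DecidableEq κ]
    (A : Matrix ι ι R) (B : Matrix κ κ R) : Matrix (ι × κ) (ι × κ) R :=
  A ⊗ₖ (1 : Matrix κ κ R) + (1 : Matrix ι ι R) ⊗ₖ B

/-- The row and column index set `Fin (n 0) × (Fin (n 1) × (⋯ × Unit))` of an iterated
Kronecker sum of square matrices of orders `n 0, n 1, …, n (m - 1)`. -/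
def KroneckerIndex : (m : ℕ) → (Fin m → ℕ) → Type
  | 0, _ => Unit
  | m + 1, n => Fin (n 0) × KroneckerIndex m fun j => n j.succ

instance KroneckerIndex.instFintype : (m : ℕ) → (n : Fin m → ℕ) → Fintype (KroneckerIndex m n)
  | 0, _ => inferInstanceAs (Fintype Unit)
  | m + 1, n =>
    letI := KroneckerIndex.instFintype m fun j => n j.succ
    inferInstanceAs (Fintype (Fin (n 0) × KroneckerIndex m fun j => n j.succ))

instance KroneckerIndex.instDecidableEq :
    (m : ℕ) → (n : Fin m → ℕ) → DecidableEq (KroneckerIndex m n)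
  | 0, _ => inferInstanceAs (DecidableEq Unit)
  | m + 1, n =>
    letI := KroneckerIndex.instDecidableEq m fun j => n j.succ
    inferInstanceAs (DecidableEq (Fin (n 0) × KroneckerIndex m fun j => n j.succ))

/-- The iterated Kronecker sum `A 0 ⊞ (A 1 ⊞ (⋯ ⊞ A (m - 1)))`. The recursion starts from the
zero matrix of order one, which is neutral for `⊞`, see `kroneckerSum_zero_unit`. -/
def iteratedKroneckerSum {R : Type*} [CommRing R] :
    (m : ℕ) → (n : Fin m → ℕ) → ((j : Fin m) → Matrix (Fin (n j)) (Fin (n j)) R) →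
      Matrix (KroneckerIndex m n) (KroneckerIndex m n) R
  | 0, _, _ => 0
  | m + 1, n, A =>
    kroneckerSum (A 0) (iteratedKroneckerSum m (fun j => n j.succ) fun j => A j.succ)

theorem kroneckerSum_zero_unit {R ι : Type*} [CommRing R] [DecidableEq ι] (A : Matrix ι ι R) :
    Matrix.reindex (Equiv.prodPUnit ι) (Equiv.prodPUnit ι)
      (kroneckerSum A (0 : Matrix Unit Unit R)) = A := by
  ext i j
  simp [kroneckerSum]

/-- The value at the complex number `z` of
`p_n(z; x_1, …, x_m) = ∏_{s_1, …, s_m = 1}^n (z^{1/n} + ε^{s_1} x_1^{1/n} + ⋯ + ε^{s_m} x_m^{1/n})`,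
with principal `n`-th roots. Here `ε` is meant to be a primitive `n`-th root of unity. -/
def nValuedProduct {m : ℕ} (n : ℕ) (ε : ℂ) (x : Fin m → ℂ) (z : ℂ) : ℂ :=
  ∏ s ∈ Fintype.piFinset fun _ : Fin m => Finset.Icc 1 n,
    (z ^ (1 / (n : ℂ)) + ∑ j, ε ^ s j * x j ^ (1 / (n : ℂ)))

end

/-! ### Eigenvalues of Kronecker sums of companion matrices. -/

section CompanionMatrices

variable {R S : Type*} [CommRing R] [CommRing S]

/-! Let `α j` be the real radicals. Both parts rest on one bound: their sum has degree at least `∏ n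
j` over ℚ. Coprimality makes the power products `∏ α j ^ e j` with `e j < n j` pairwise
incommensurable (`incommensurable_radicals`). Irrational positive radicals have trace zero, so these
products are linearly independent (`prod_le_finrank_of_incommensurable`). The sum is a primitive
element, because conjugates of `α j` have modulus `α j` (`injective_algHom_apply_sum`). In part (1)
the characteristic polynomial is monic of degree `∏ n j` and vanishes at the sum, so it is the
minimal polynomial. In part (2) the product, as a function of `w = z ^ (1/n)`, is the minimal
polynomial `M` of `-∑ α j`. It is invariant under `w ↦ ε w`, so `M(w) = P(w ^ n)`, and `P` inherits
irreducibility from `M`. -/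

theorem radicalCompanion_map (f : R →+* S) (n : ℕ) (a : R) :
    (radicalCompanion n a).map f = radicalCompanion n (f a) := by
  ext i j
  simp only [radicalCompanion, frobeniusCompanion, Matrix.map_apply, Matrix.of_apply]
  split_ifs <;> simp [coeff_X_pow, coeff_C, apply_ite f]

theorem kroneckerSum_map {ι κ : Type*} [DecidableEq ι] [DecidableEq κ] (f : R →+* S)
    (A : Matrix ι ι R) (B : Matrix κ κ R) :
    (kroneckerSum A B).map f = kroneckerSum (A.map f) (B.map f) := by
  ext i j
  simp [kroneckerSum, Matrix.one_apply, apply_ite f]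

theorem iteratedKroneckerSum_map (f : R →+* S) (m : ℕ) (n : Fin m → ℕ)
    (A : (j : Fin m) → Matrix (Fin (n j)) (Fin (n j)) R) :
    (iteratedKroneckerSum m n A).map f = iteratedKroneckerSum m n fun j => (A j).map f := by
  induction m with
  | zero => ext i j; simp [iteratedKroneckerSum]
  | succ m ih =>
    simp only [iteratedKroneckerSum]
    rw [← ih]
    exact kroneckerSum_map f _ _

theorem KroneckerIndex.card (m : ℕ) (n : Fin m → ℕ) :
    Fintype.card (KroneckerIndex m n) = ∏ j, n j := by
  induction m with
  | zero => rfl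
  | succ m ih =>
    rw [Fin.prod_univ_succ, ← ih]
    exact (Fintype.card_prod (Fin (n 0)) (KroneckerIndex m fun j => n j.succ)).trans (by simp)

-- The matrix shifts the vector of powers by one; the last column closes the cycle through `α ^ n =
-- a`.
open Matrix in
theorem vecMul_radicalCompanion {n : ℕ} {a α : R} (h : α ^ n = a) :
    (fun i : Fin n => α ^ (i : ℕ)) ᵥ* radicalCompanion n a = α • fun i : Fin n => α ^ (i : ℕ) := by
  ext j
  simp only [Matrix.vecMul, dotProduct, radicalCompanion, frobeniusCompanion, Matrix.of_apply,
    Pi.smul_apply, smul_eq_mul, ← pow_succ']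
  have hj := j.2
  split_ifs with hjn
  · rw [hjn, Finset.sum_eq_single (⟨0, by omega⟩ : Fin n)]
    · have : (0 : ℕ) ≠ n := by omega
      simp [coeff_X_pow, this, h]
    · intro i _ hi
      have h1 : (i : ℕ) ≠ n := i.2.ne
      have h2 : (i : ℕ) ≠ 0 := fun h => hi (Fin.ext h)
      simp [coeff_X_pow, coeff_C, h1, h2]
    · simp
  · rw [Finset.sum_eq_single (⟨(j : ℕ) + 1, by omega⟩ : Fin n)]
    · simp
    · intro i _ hi
      rw [if_neg fun h => hi (Fin.ext h), mul_zero]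
    · simp

open Matrix in
theorem vecMul_kroneckerSum {ι κ : Type*} [Fintype ι] [Fintype κ] [DecidableEq ι] [DecidableEq κ]
    {A : Matrix ι ι R} {B : Matrix κ κ R} {v : ι → R} {w : κ → R} {α β : R}
    (hv : v ᵥ* A = α • v) (hw : w ᵥ* B = β • w) :
    (fun p : ι × κ => v p.1 * w p.2) ᵥ* kroneckerSum A B =
      (α + β) • fun p : ι × κ => v p.1 * w p.2 := by
  ext ⟨i, j⟩
  have h1 := congrFun hv i
  have h2 := congrFun hw j
  simp only [Matrix.vecMul, dotProduct, Pi.smul_apply, smul_eq_mul] at h1 h2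
  simp only [Matrix.vecMul, dotProduct, kroneckerSum, Matrix.add_apply, kroneckerMap_apply,
    Pi.smul_apply, smul_eq_mul, mul_add, Finset.sum_add_distrib, Fintype.sum_prod_type]
  have e1 : ∑ x, ∑ y, v x * w y * (A x i * (1 : Matrix κ κ R) y j) = (∑ x, v x * A x i) * w j := by
    rw [Finset.sum_mul]
    refine Finset.sum_congr rfl fun x _ => ?_
    rw [Finset.sum_eq_single j] <;> simp +contextual [mul_right_comm]
  have e2 : ∑ x, ∑ y, v x * w y * ((1 : Matrix ι ι R) x i * B y j) = v i * ∑ y, w y * B y j := by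
    rw [Finset.mul_sum, Finset.sum_comm]
    refine Finset.sum_congr rfl fun y _ => ?_
    rw [Finset.sum_eq_single i] <;> simp +contextual [mul_assoc]
  rw [e1, e2, h1, h2]
  ring

open Matrix in
theorem exists_vecMul_iteratedKroneckerSum_radicalCompanion [IsDomain R] (m : ℕ) (n : Fin m → ℕ)
    (a α : Fin m → R) (hn : ∀ j, 0 < n j) (h : ∀ j, α j ^ n j = a j) :
    ∃ v : KroneckerIndex m n → R, v ≠ 0 ∧
      v ᵥ* iteratedKroneckerSum m n (fun j => radicalCompanion (n j) (a j)) = (∑ j, α j) • v := by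
  induction m with
  | zero =>
    exact ⟨fun _ => 1, fun h => one_ne_zero (congrFun h ()), by
      simp [iteratedKroneckerSum, Matrix.vecMul_zero]⟩
  | succ m ih =>
    obtain ⟨w, hw0, hw⟩ := ih (fun j => n j.succ) (fun j => a j.succ) (fun j => α j.succ)
      (fun j => hn _) fun j => h _
    obtain ⟨i, hi⟩ := Function.ne_iff.mp hw0
    refine ⟨fun p : Fin (n 0) × KroneckerIndex m (fun j => n j.succ) => α 0 ^ (p.1 : ℕ) * w p.2,
      fun h0 => hi ?_, ?_⟩
    · have := congrFun h0 (⟨0, hn 0⟩, i)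
      exact (by simpa using this : w i = (0 : KroneckerIndex (m + 1) n → R) (⟨0, hn 0⟩, i))
    · rw [Fin.sum_univ_succ]
      exact vecMul_kroneckerSum (vecMul_radicalCompanion (h 0)) hw

/-- The sum of the radicals is a root of the characteristic polynomial of the Kronecker sum. -/
theorem aeval_charpoly_iteratedKroneckerSum_radicalCompanion [IsDomain S] [Algebra R S]
    (m : ℕ) (n : Fin m → ℕ) (a : Fin m → R) (α : Fin m → S) (hn : ∀ j, 0 < n j)
    (h : ∀ j, α j ^ n j = algebraMap R S (a j)) :
    aeval (∑ j, α j)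
      (iteratedKroneckerSum m n fun j => radicalCompanion (n j) (a j)).charpoly = 0 := by
  obtain ⟨v, hv0, hv⟩ := exists_vecMul_iteratedKroneckerSum_radicalCompanion m n _ α hn h
  rw [aeval_def, eval₂_eq_eval_map, ← Matrix.charpoly_map, iteratedKroneckerSum_map]
  simp only [radicalCompanion_map]
  rw [Matrix.eval_charpoly]
  refine Matrix.exists_vecMul_eq_zero_iff.mp ⟨v, hv0, ?_⟩
  rw [Matrix.vecMul_sub, hv]
  ext i
  rw [Matrix.scalar_apply, Pi.sub_apply, Matrix.vecMul_diagonal]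
  simp [mul_comm]

end CompanionMatrices

/-! ### Degrees and conjugates of sums of positive real radicals. -/

section RealRadicals

/-- A positive real number, some positive power of which is rational, has a binomial as its
minimal polynomial. -/
theorem exists_minpoly_eq_X_pow_sub_C {b : ℝ} (hb : 0 < b) {N : ℕ} (hN : 0 < N)
    (h : ∃ q : ℚ, b ^ N = q) : ∃ (d : ℕ) (c : ℚ), 0 < d ∧ minpoly ℚ b = X ^ d - C c := by
  classical
  have hex : ∃ d : ℕ, 0 < d ∧ ∃ q : ℚ, b ^ d = q := ⟨N, hN, h⟩
  obtain ⟨hd, c, hc⟩ := Nat.find_spec hex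
  have hmin := fun e => Nat.find_min' hex (m := e)
  set d := Nat.find hex
  have hdvd : minpoly ℚ b ∣ X ^ d - C c := minpoly.dvd _ _ (by simp [hc])
  have hmonic : (X ^ d - C c : ℚ[X]).Monic := monic_X_pow_sub_C c hd.ne'
  have hint : IsIntegral ℚ b := ⟨X ^ d - C c, hmonic, by simp [hc]⟩
  refine ⟨d, c, hd, eq_of_monic_of_dvd_of_natDegree_le (minpoly.monic hint) hmonic hdvd ?_ |>.symm⟩
  rw [natDegree_X_pow_sub_C]
  -- Up to sign the constant term is the product of the conjugates, all of modulus `b`. So `b ^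
  -- natDegree` is rational, and minimality of `d` applies.
  refine hmin _ ⟨minpoly.natDegree_pos hint, |(minpoly ℚ b).coeff 0|, ?_⟩
  set q := (minpoly ℚ b).map (algebraMap ℚ ℂ) with hq
  have hsplit : q.Splits := IsAlgClosed.splits _
  have hqm : q.Monic := (minpoly.monic hint).map _
  have hcoeff := hsplit.coeff_zero_eq_prod_roots_of_monic hqm
  have hnorm : ∀ r ∈ q.roots, ‖r‖ = b := by
    intro r hr
    have h0 : aeval r (X ^ d - C c : ℚ[X]) = 0 := by
      refine aeval_eq_zero_of_dvd_aeval_eq_zero hdvd ?_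
      rw [aeval_def, eval₂_eq_eval_map]
      exact (mem_roots'.mp hr).2
    have h1 : r ^ d = (c : ℂ) := by simpa [sub_eq_zero] using h0
    have h2 : ‖r‖ ^ d = b ^ d := by
      rw [← norm_pow, h1, hc, ← Complex.ofReal_ratCast, Complex.norm_real, Real.norm_eq_abs, ← hc,
        abs_of_pos (by positivity)]
    exact (pow_left_inj₀ (norm_nonneg _) hb.le hd.ne').mp h2
  have hprod : ‖q.roots.prod‖ = b ^ q.natDegree := by
    rw [hsplit.natDegree_eq_card_roots, ← Multiset.prod_replicate, ← Multiset.map_const',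
      ← Multiset.map_congr rfl hnorm]
    exact map_multiset_prod (normHom : ℂ →*₀ ℝ) _
  have hfin := congrArg norm hcoeff
  rw [norm_mul, norm_pow, norm_neg, norm_one, one_pow, one_mul, hprod, hq, coeff_map,
    natDegree_map, eq_ratCast, ← Complex.ofReal_ratCast, Complex.norm_real, Real.norm_eq_abs] at hfin
  rw [← hfin]
  push_cast
  rfl

/-- The minimal polynomial is `X ^ d - C c` with `d ≥ 2`, so its coefficient in degree `d - 1`
vanishes. -/
theorem trace_eq_zero_of_irrational_radical {K : IntermediateField ℚ ℝ} [FiniteDimensional ℚ K]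
    {b : K} (hb : 0 < (b : ℝ)) {N : ℕ} (hN : 0 < N) (h : ∃ q : ℚ, (b : ℝ) ^ N = q)
    (hirr : Irrational (b : ℝ)) : Algebra.trace ℚ K b = 0 := by
  obtain ⟨d, c, hd, hmin⟩ := exists_minpoly_eq_X_pow_sub_C hb hN h
  have hd1 : d ≠ 1 := by
    rintro rfl
    have := minpoly.aeval ℚ (b : ℝ)
    rw [hmin] at this
    simp only [pow_one, map_sub, aeval_X, aeval_C, sub_eq_zero] at this
    exact hirr ⟨c, by simpa using this.symm⟩
  rw [trace_eq_finrank_mul_minpoly_nextCoeff, show minpoly ℚ b = X ^ d - C c by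
    rw [← hmin]; exact (minpoly.algebraMap_eq (algebraMap K ℝ).injective b).symm]
  rw [nextCoeff_of_natDegree_pos (by rw [natDegree_X_pow_sub_C]; exact hd), natDegree_X_pow_sub_C,
    coeff_sub, coeff_X_pow, coeff_C, if_neg (by omega), if_neg (by omega)]
  simp

variable {ι : Type*} [Fintype ι]

/-- The field generated by finitely many real radicals has full degree, if the power products of
the radicals are incommensurable. -/
theorem prod_le_finrank_of_incommensurable {K : IntermediateField ℚ ℝ} [FiniteDimensional ℚ K]
    {α : ι → K} {n : ι → ℕ} (hα : ∀ j, 0 < (α j : ℝ)) (hn : ∀ j, 0 < n j)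
    (ha : ∀ j, ∃ a : ℚ, (α j : ℝ) ^ n j = a)
    (hind : ∀ e f : ι → ℕ, (∀ j, e j < n j) → (∀ j, f j < n j) → ∀ q : ℚ,
      ∏ j, (α j : ℝ) ^ e j = q * ∏ j, (α j : ℝ) ^ f j → e = f) :
    ∏ j, n j ≤ Module.finrank ℚ K := by
  classical
  let b : ((j : ι) → Fin (n j)) → K := fun e => ∏ j, α j ^ (e j : ℕ)
  have hb : ∀ e, (b e : ℝ) = ∏ j, (α j : ℝ) ^ (e j : ℕ) := fun e => by simp [b]
  have hpos : ∀ e, 0 < (b e : ℝ) := fun e => by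
    rw [hb]; exact Finset.prod_pos fun j _ => pow_pos (hα j) _
  have hne : ∀ e, b e ≠ 0 := fun e h => (hpos e).ne' (by simp [h])
  have hN : 0 < ∏ j, n j := Finset.prod_pos fun j _ => hn j
  have hpow : ∀ e, ∃ q : ℚ, (b e : ℝ) ^ (∏ j, n j) = q := by
    intro e
    choose a ha using ha
    refine ⟨∏ j, (a j ^ (∏ i ∈ Finset.univ.erase j, n i)) ^ (e j : ℕ), ?_⟩
    rw [hb, ← Finset.prod_pow]
    push_cast
    refine Finset.prod_congr rfl fun j _ => ?_
    rw [← ha, ← pow_mul (α j : ℝ) (n j), Finset.mul_prod_erase _ _ (Finset.mem_univ j), ← pow_mul,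
      ← pow_mul, mul_comm]
  -- The quotient is again a positive radical, irrational by incommensurability.
  have htr : ∀ e f, e ≠ f → Algebra.trace ℚ K (b e * (b f)⁻¹) = 0 := by
    intro e f hef
    obtain ⟨q, hq⟩ := hpow e
    obtain ⟨r, hr⟩ := hpow f
    refine trace_eq_zero_of_irrational_radical (N := ∏ j, n j) ?_ hN ⟨q * r⁻¹, ?_⟩ ?_
    · have := hpos e
      have := hpos f
      push_cast
      positivity
    · push_cast
      rw [mul_pow, inv_pow, hq, hr]
    · rintro ⟨q, hq⟩
      have := (hpos f).ne'
      push_cast at hq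
      have h1 := hind (fun j => e j) (fun j => f j) (fun j => (e j).2) (fun j => (f j).2) q (by
        rw [← hb, ← hb, hq]; field_simp)
      exact hef (funext fun j => Fin.ext (congrFun h1 j))
  have hli : LinearIndependent ℚ b := by
    rw [Fintype.linearIndependent_iff]
    intro g hg f
    -- Dividing the relation by `b f` and taking traces leaves only `g f` times the degree.
    have h1 : Algebra.trace ℚ K ((∑ e, g e • b e) * (b f)⁻¹) = 0 := by rw [hg]; simp
    rw [Finset.sum_mul, map_sum, Finset.sum_eq_single f] at h1
    · rw [smul_mul_assoc, mul_inv_cancel₀ (hne f), map_smul,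
        ← map_one (algebraMap ℚ K), Algebra.trace_algebraMap] at h1
      simpa [Module.finrank_pos.ne'] using h1
    · intro e _ hef
      rw [smul_mul_assoc, map_smul, htr e f hef, smul_zero]
    · simp
  simpa using hli.fintype_card_le_finrank

/-- The sum of positive real radicals generates the field that they generate. -/
theorem injective_algHom_apply_sum {K : IntermediateField ℚ ℝ} {α : ι → K} {n : ι → ℕ}
    (hα : ∀ j, 0 < (α j : ℝ)) (hn : ∀ j, 0 < n j) (ha : ∀ j, ∃ a : ℚ, (α j : ℝ) ^ n j = a)
    (hK : K = IntermediateField.adjoin ℚ (Set.range fun j => (α j : ℝ))) :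
    ∀ ψ : K →ₐ[ℚ] ℂ, ((∑ j, α j : K) : ℂ) = ψ (∑ j, α j) →
      ((IsScalarTower.toAlgHom ℚ ℝ ℂ).comp K.val) = ψ := by
  intro ψ h
  have hnorm : ∀ j, ‖ψ (α j)‖ = α j := by
    intro j
    obtain ⟨a, ha⟩ := ha j
    have h1 : α j ^ n j = algebraMap ℚ K a := Subtype.ext (by simpa using ha)
    have h2 := congrArg ψ h1
    rw [map_pow, AlgHom.commutes, eq_ratCast] at h2
    have h3 : ‖ψ (α j)‖ ^ n j = (α j : ℝ) ^ n j := by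
      rw [← norm_pow, h2, ← Complex.ofReal_ratCast, ← ha, Complex.norm_real, Real.norm_eq_abs,
        abs_of_pos (pow_pos (hα j) _)]
    exact (pow_left_inj₀ (norm_nonneg _) (hα j).le (hn j).ne').mp h3
  -- Each real part is at most the modulus `α j`, and the sums agree, so equality holds termwise.
  have hre : ∀ j ∈ Finset.univ, (ψ (α j)).re = α j := by
    refine (Finset.sum_eq_sum_iff_of_le fun j _ => ?_).mp ?_
    · exact (Complex.re_le_norm _).trans (hnorm j).le
    · have := congrArg Complex.re h
      rw [map_sum] at this
      simpa using this.symm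
  have hval : ∀ j, ψ (α j) = ((α j : ℝ) : ℂ) := by
    intro j
    have h1 := hre j (Finset.mem_univ j)
    have h2 : (ψ (α j)).im = 0 := by
      have := Complex.sq_norm_sub_sq_re (ψ (α j))
      rw [hnorm, h1, sub_self] at this
      exact pow_eq_zero_iff two_ne_zero |>.mp this.symm
    exact Complex.ext (by simpa using h1) (by simpa using h2)
  refine IntermediateField.algHom_ext_of_eq_adjoin ℚ hK fun x hx => ?_
  obtain ⟨j, rfl⟩ := hx
  exact (hval j).symm

/-- A common setting for sums of incommensurable positive real radicals. -/
theorem exists_field_of_incommensurable {α : ι → ℝ} {n : ι → ℕ} (hα : ∀ j, 0 < α j)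
    (hn : ∀ j, 0 < n j) (ha : ∀ j, ∃ a : ℚ, α j ^ n j = a)
    (hind : ∀ e f : ι → ℕ, (∀ j, e j < n j) → (∀ j, f j < n j) → ∀ q : ℚ,
      ∏ j, α j ^ e j = q * ∏ j, α j ^ f j → e = f) :
    ∃ (K : IntermediateField ℚ ℝ) (β : ι → K), FiniteDimensional ℚ K ∧ (∀ j, (β j : ℝ) = α j) ∧
      ∏ j, n j ≤ (minpoly ℚ (∑ j, β j)).natDegree := by
  let K := IntermediateField.adjoin ℚ (Set.range α)
  let β : ι → K := fun j => ⟨α j, IntermediateField.subset_adjoin _ _ ⟨j, rfl⟩⟩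
  have hfin : FiniteDimensional ℚ K := by
    refine IntermediateField.finiteDimensional_adjoin ?_
    rintro _ ⟨j, rfl⟩
    obtain ⟨a, ha⟩ := ha j
    exact ⟨X ^ n j - C a, monic_X_pow_sub_C a (hn j).ne', by simp [ha]⟩
  refine ⟨K, β, hfin, fun j => rfl, ?_⟩
  have hprim := (Field.primitive_element_iff_algHom_eq_of_eval ℚ ℂ
    (fun x => IsAlgClosed.splits _) (∑ j, β j) ((IsScalarTower.toAlgHom ℚ ℝ ℂ).comp K.val)).mpr
    (injective_algHom_apply_sum (α := β) hα hn ha rfl)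
  exact (prod_le_finrank_of_incommensurable (α := β) hα hn ha hind).trans
    ((Field.primitive_element_iff_minpoly_natDegree_eq ℚ _).mp hprim).ge

theorem prod_le_natDegree_minpoly_sum {α : ι → ℝ} {n : ι → ℕ} (hα : ∀ j, 0 < α j)
    (hn : ∀ j, 0 < n j) (ha : ∀ j, ∃ a : ℚ, α j ^ n j = a)
    (hind : ∀ e f : ι → ℕ, (∀ j, e j < n j) → (∀ j, f j < n j) → ∀ q : ℚ,
      ∏ j, α j ^ e j = q * ∏ j, α j ^ f j → e = f) :
    ∏ j, n j ≤ (minpoly ℚ (∑ j, α j)).natDegree := by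
  obtain ⟨K, β, _, hβ, h⟩ := exists_field_of_incommensurable hα hn ha hind
  have : ∑ j, α j = algebraMap K ℝ (∑ j, β j) := by
    rw [map_sum]; exact Finset.sum_congr rfl fun j _ => (hβ j).symm
  rwa [this, minpoly.algebraMap_eq (algebraMap K ℝ).injective]

/-- The conjugates of a sum of incommensurable radicals of the same order `n` arise by multiplying
the radicals by arbitrary `n`-th roots of unity. -/
theorem aeval_minpoly_neg_sum_eq_prod [DecidableEq ι] {α : ι → ℝ} {n : ℕ} (hα : ∀ j, 0 < α j)
    (hn : 0 < n) (ha : ∀ j, ∃ a : ℚ, α j ^ n = a)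
    (hind : ∀ e f : ι → ℕ, (∀ j, e j < n) → (∀ j, f j < n) → ∀ q : ℚ,
      ∏ j, α j ^ e j = q * ∏ j, α j ^ f j → e = f) (w : ℂ) :
    aeval w (minpoly ℚ (-∑ j, α j)) =
      ∏ u ∈ Fintype.piFinset fun _ : ι => nthRootsFinset n (1 : ℂ), (w + ∑ j, u j * α j) := by
  obtain ⟨K, β, _, hβ, hdeg⟩ :=
    exists_field_of_incommensurable (n := fun _ => n) hα (fun _ => hn) ha hind
  have hθ : -∑ j, α j = algebraMap K ℝ (-∑ j, β j) := by
    rw [map_neg, map_sum]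
    exact congrArg Neg.neg (Finset.sum_congr rfl fun j _ => (hβ j).symm)
  rw [hθ, minpoly.algebraMap_eq (algebraMap K ℝ).injective]
  have hint : IsIntegral ℚ (-∑ j, β j) := IsIntegral.of_finite _ _
  set M := minpoly ℚ (-∑ j, β j) with hM
  have hMdeg : n ^ Fintype.card ι ≤ M.natDegree := by
    rw [hM, minpoly.neg]
    have h0 : (-1 : ℚ[X]) ^ (minpoly ℚ (∑ j, β j)).natDegree =
        C ((-1) ^ (minpoly ℚ (∑ j, β j)).natDegree) := by
      simp
    rw [h0, natDegree_C_mul (by simp), natDegree_comp, natDegree_neg, natDegree_X, mul_one]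
    simpa using hdeg
  set T := Fintype.piFinset fun _ : ι => nthRootsFinset n (1 : ℂ) with hT
  have hTcard : T.card = n ^ Fintype.card ι := by
    rw [hT, Fintype.card_piFinset, (Complex.isPrimitiveRoot_exp n hn.ne').card_nthRootsFinset]
    simp
  have hsplit : (M.map (algebraMap ℚ ℂ)).Splits := IsAlgClosed.splits _
  have hmonic : (M.map (algebraMap ℚ ℂ)).Monic := (minpoly.monic hint).map _
  have hnodup : (M.map (algebraMap ℚ ℂ)).roots.Nodup :=
    nodup_roots (minpoly.irreducible hint).separable.map
  set S := (M.map (algebraMap ℚ ℂ)).roots.toFinset with hS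
  have hScard : S.card = M.natDegree := by
    rw [hS, Multiset.toFinset_card_of_nodup hnodup, ← hsplit.natDegree_eq_card_roots, natDegree_map]
  -- Every root is the image of `-∑ β j` under an embedding, which multiplies each radical by an
  -- `n`-th root of unity.
  have hsub : S ⊆ T.image fun u => -∑ j, u j * (α j : ℂ) := by
    intro r hr
    have hr' : r ∈ M.rootSet ℂ := by
      rw [hS, Multiset.mem_toFinset] at hr
      simpa [rootSet_def, aroots_def] using hr
    rw [hM, ← (Algebra.IsAlgebraic.of_finite ℚ K).range_eval_eq_rootSet_minpoly ℂ] at hr'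
    obtain ⟨ψ, rfl⟩ := hr'
    rw [Finset.mem_image]
    refine ⟨fun j => ψ (β j) / α j, ?_, ?_⟩
    · rw [hT, Fintype.mem_piFinset]
      intro j
      obtain ⟨a, ha⟩ := ha j
      have h1 : β j ^ n = algebraMap ℚ K a := Subtype.ext (by simpa [hβ] using ha)
      have h2 := congrArg ψ h1
      rw [map_pow, AlgHom.commutes, eq_ratCast] at h2
      have h3 : (α j : ℂ) ^ n = a := by exact_mod_cast congrArg (fun t : ℝ => (t : ℂ)) ha
      rw [mem_nthRootsFinset hn, div_pow, h2, ← h3, div_self]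
      exact pow_ne_zero _ (by exact_mod_cast (hα j).ne')
    · simp only [map_neg, map_sum, neg_inj]
      refine Finset.sum_congr rfl fun j _ => div_mul_cancel₀ _ ?_
      exact_mod_cast (hα j).ne'
  -- Counting forces equality: all choices of roots of unity occur, and they give distinct
  -- conjugates.
  have hcard : T.card ≤ S.card := by rw [hTcard, hScard]; exact hMdeg
  have himage : S = T.image fun u => -∑ j, u j * (α j : ℂ) :=
    Finset.eq_of_subset_of_card_le hsub (Finset.card_image_le.trans hcard)
  have hinj : Set.InjOn (fun u : ι → ℂ => -∑ j, u j * (α j : ℂ)) T :=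
    Finset.card_image_iff.mp (le_antisymm Finset.card_image_le (himage ▸ hcard))
  rw [aeval_def, eval₂_eq_eval_map, hsplit.eval_eq_prod_roots_of_monic hmonic,
    ← Multiset.dedup_eq_self.mpr hnodup]
  change ∏ r ∈ S, (w - r) = _
  rw [himage, Finset.prod_image hinj]
  simp

end RealRadicals

/-! ### Arithmetic of radicals of coprime integers. -/

section Incommensurability

/-- Multiplying by `B ^ (K - 1)` makes the right side a `K`-th power. Cancelling `v ^ K` shows `x`
times a coprime factor to be a `K`-th power, hence `x` is one. -/
theorem exists_eq_pow_of_pow_mul_eq_pow_mul {K x A B u v : ℕ} (hv : 0 < v)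
    (hK : 0 < K) (hA : x.Coprime A) (hB : x.Coprime B) (h : v ^ K * (x * A) = u ^ K * B) :
    ∃ c, x = c ^ K := by
  have h1 : v ^ K * (x * (A * B ^ (K - 1))) = (u * B) ^ K := by
    rw [mul_pow, ← Nat.sub_add_cancel hK, pow_succ B, Nat.sub_add_cancel hK]
    linear_combination (B ^ (K - 1)) * h
  obtain ⟨w, hw⟩ := (Nat.pow_dvd_pow_iff hK.ne').mp (Dvd.intro _ h1)
  rw [hw, mul_pow] at h1
  refine exists_eq_pow_of_mul_eq_pow (b := A * B ^ (K - 1)) ?_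
    (Nat.eq_of_mul_eq_mul_left (pow_pos hv K) h1)
  exact Nat.isUnit_iff.mpr (Nat.Coprime.mul_right hA (hB.pow_right _))

variable {ι : Type*} [Fintype ι]

/-- If `e j = f j + d + 1`, raising the relation to the power `K = ∏ k i` gives an equation of
integers. By coprimality the surplus power of `x j` is some `c ^ K`, so `α j ^ (d + 1) = c`, against
the minimality of `n j`. -/
theorem exponent_le_of_prod_radicals_eq {α : ι → ℝ} {k x n : ι → ℕ} (hα : ∀ j, 0 < α j)
    (hk : ∀ j, 0 < k j) (hx : ∀ j, α j ^ k j = x j)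
    (hcop : ∀ i j, i ≠ j → Nat.Coprime (x i) (x j))
    (hmin : ∀ j N, 0 < N → (∃ b : ℕ, α j ^ N = b) → n j ≤ N) {e f : ι → ℕ}
    (he : ∀ j, e j < n j) {q : ℚ} (h : ∏ j, α j ^ e j = q * ∏ j, α j ^ f j) (j : ι) :
    e j ≤ f j := by
  classical
  by_contra! hlt
  obtain ⟨d, hd⟩ := Nat.exists_eq_add_of_lt hlt
  have hq : 0 < (q : ℝ) :=
    pos_of_mul_pos_left (h ▸ Finset.prod_pos fun j _ => pow_pos (hα j) _)
      (Finset.prod_nonneg fun j _ => (pow_pos (hα j) _).le)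
  set u := q.num.natAbs with hu
  set v := q.den with hv
  have hquv : (v : ℝ) * q = u := by
    have h1 : (u : ℤ) = q.num := Int.natAbs_of_nonneg (Rat.num_nonneg.mpr (by exact_mod_cast hq.le))
    have h2 : (v : ℚ) * q = u := by
      rw [mul_comm, hv, Rat.mul_den_eq_num, ← h1]; rfl
    exact_mod_cast congrArg (fun t : ℚ => (t : ℝ)) h2
  set K := ∏ j, k j with hK
  have hK0 : 0 < K := Finset.prod_pos fun j _ => hk j
  set l : ι → ℕ := fun j => ∏ i ∈ Finset.univ.erase j, k i with hl
  have hαK : ∀ i, α i ^ K = (x i : ℝ) ^ l i := fun i => by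
    rw [hK, ← Finset.mul_prod_erase _ _ (Finset.mem_univ i), pow_mul, hx]
  have hx0 : ∀ i, 0 < x i := fun i => by exact_mod_cast (hx i) ▸ pow_pos (hα i) (k i)
  have hprod : ∀ g : ι → ℕ, (∏ i, α i ^ g i) ^ K = ((∏ i, x i ^ (l i * g i) : ℕ) : ℝ) := by
    intro g
    rw [← Finset.prod_pow]
    push_cast
    exact Finset.prod_congr rfl fun i _ => by rw [pow_mul, ← hαK, pow_right_comm]
  have hnat : v ^ K * ∏ i, x i ^ (l i * e i) = u ^ K * ∏ i, x i ^ (l i * f i) := by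
    have : ((v : ℝ) * ∏ j, α j ^ e j) ^ K = (u * ∏ j, α j ^ f j) ^ K := by
      rw [h, ← hquv, mul_assoc]
    rw [mul_pow, mul_pow, hprod, hprod] at this
    exact_mod_cast this
  rw [← Finset.mul_prod_erase _ _ (Finset.mem_univ j), ← Finset.mul_prod_erase _ _
    (Finset.mem_univ j), hd, add_assoc, mul_add, pow_add] at hnat
  have hcopr : ∀ g : ι → ℕ, (x j ^ (l j * (d + 1))).Coprime
      (∏ i ∈ Finset.univ.erase j, x i ^ (l i * g i)) := fun g =>
    Nat.Coprime.prod_right fun i hi =>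
      Nat.Coprime.pow _ _ (hcop j i (Finset.ne_of_mem_erase hi).symm)
  obtain ⟨c, hc⟩ := exists_eq_pow_of_pow_mul_eq_pow_mul (v := v) (u := u) q.den_pos hK0
    (hcopr e) (hcopr f)
    (Nat.eq_of_mul_eq_mul_left (pow_pos (hx0 j) (l j * f j)) (by linear_combination hnat))
  have hroot : α j ^ (d + 1) = c := by
    refine (pow_left_inj₀ (pow_pos (hα j) _).le c.cast_nonneg hK0.ne').mp ?_
    rw [pow_right_comm, hαK, ← pow_mul]
    exact_mod_cast hc
  have := hmin j (d + 1) d.succ_pos ⟨c, hroot⟩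
  have := he j
  omega

/-- Radicals of pairwise coprime positive integers are incommensurable. -/
theorem incommensurable_radicals {α : ι → ℝ} {k x n : ι → ℕ} (hα : ∀ j, 0 < α j)
    (hk : ∀ j, 0 < k j) (hx : ∀ j, α j ^ k j = x j)
    (hcop : ∀ i j, i ≠ j → Nat.Coprime (x i) (x j))
    (hmin : ∀ j N, 0 < N → (∃ b : ℕ, α j ^ N = b) → n j ≤ N) (e f : ι → ℕ)
    (he : ∀ j, e j < n j) (hf : ∀ j, f j < n j) (q : ℚ)
    (h : ∏ j, α j ^ e j = q * ∏ j, α j ^ f j) : e = f := by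
  have hq : (q : ℝ) ≠ 0 := by
    rintro hq
    rw [hq, zero_mul] at h
    exact (Finset.prod_pos fun j _ => pow_pos (hα j) (e j)).ne' h
  funext j
  refine le_antisymm (exponent_le_of_prod_radicals_eq hα hk hx hcop hmin he h j)
    (exponent_le_of_prod_radicals_eq (q := q⁻¹) hα hk hx hcop hmin hf ?_ j)
  rw [h]
  push_cast
  field_simp

end Incommensurability

/-! ### Symmetry of the product over roots of unity. -/

section SymmetricProduct

variable {ι : Type*} [Fintype ι] [DecidableEq ι]

/-- Factor `ε` out of every term and reindex by `u ↦ ε⁻¹ u`. The number of factors is a positive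
power of `n` as `ι` is nonempty; for empty `ι` the product would be `w` itself. -/
theorem prod_nthRootsFinset_mul_left {n : ℕ} (hn : 0 < n) (hι : Nonempty ι) {ε : ℂ} (hε : ε ^ n = 1)
    (α : ι → ℂ) (w : ℂ) :
    ∏ u ∈ Fintype.piFinset fun _ : ι => nthRootsFinset n (1 : ℂ), (ε * w + ∑ j, u j * α j) =
      ∏ u ∈ Fintype.piFinset fun _ : ι => nthRootsFinset n (1 : ℂ), (w + ∑ j, u j * α j) := by
  have hε0 : ε ≠ 0 := fun h => by simp [h, hn.ne'] at hε
  have hcard : ε ^ (Fintype.piFinset fun _ : ι => nthRootsFinset n (1 : ℂ)).card = 1 := by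
    rw [Fintype.card_piFinset, (Complex.isPrimitiveRoot_exp n hn.ne').card_nthRootsFinset,
      Finset.prod_const, Finset.card_univ,
      ← Nat.sub_add_cancel (Fintype.card_pos_iff.mpr hι), pow_succ', pow_mul, hε, one_pow]
  refine Eq.trans ?_ (one_mul _)
  rw [← congrArg (· * _) hcard, ← Finset.prod_const, ← Finset.prod_mul_distrib]
  refine Finset.prod_nbij' (fun u j => ε⁻¹ * u j) (fun u j => ε * u j) ?_ ?_ ?_ ?_ ?_
  · intro u hu
    simp only [Fintype.mem_piFinset, mem_nthRootsFinset hn] at hu ⊢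
    intro j
    rw [mul_pow, hu, inv_pow, hε, inv_one, one_mul]
  · intro u hu
    simp only [Fintype.mem_piFinset, mem_nthRootsFinset hn] at hu ⊢
    intro j
    rw [mul_pow, hu, hε, one_mul]
  · intro u _
    simp [hε0]
  · intro u _
    simp [hε0]
  · intro u _
    rw [mul_add, Finset.mul_sum]
    refine congrArg _ (Finset.sum_congr rfl fun j _ => ?_)
    field_simp

theorem prod_pow_primitiveRoot_eq_prod_nthRootsFinset {n : ℕ} (hn : 0 < n) {ε : ℂ}
    (hε : IsPrimitiveRoot ε n) (g : (ι → ℂ) → ℂ) :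
    ∏ s ∈ Fintype.piFinset fun _ : ι => Finset.Icc 1 n, g (fun j => ε ^ s j) =
      ∏ u ∈ Fintype.piFinset fun _ : ι => nthRootsFinset n (1 : ℂ), g u := by
  have hmaps : ∀ s ∈ Fintype.piFinset fun _ : ι => Finset.Icc 1 n, (fun j => ε ^ s j) ∈
      Fintype.piFinset fun _ : ι => nthRootsFinset n (1 : ℂ) := by
    intro s _
    simp only [Fintype.mem_piFinset, mem_nthRootsFinset hn]
    intro j
    rw [pow_right_comm, hε.pow_eq_one, one_pow]
  have hsurj : Set.SurjOn (fun (s : ι → ℕ) j => ε ^ s j)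
      (Fintype.piFinset fun _ : ι => Finset.Icc 1 n)
      (Fintype.piFinset fun _ : ι => nthRootsFinset n (1 : ℂ)) := by
    intro u hu
    simp only [Finset.mem_coe, Fintype.mem_piFinset, mem_nthRootsFinset hn] at hu
    have : ∀ j, ∃ i ∈ Finset.Icc 1 n, ε ^ i = u j := by
      intro j
      have : NeZero n := ⟨hn.ne'⟩
      obtain ⟨i, hi, hiu⟩ := hε.eq_pow_of_pow_eq_one (hu j)
      -- Exponents run from 1 to `n`, so `n` stands in for 0.
      rcases Nat.eq_zero_or_pos i with rfl | hi0
      · exact ⟨n, Finset.mem_Icc.mpr ⟨hn, le_rfl⟩, by rw [hε.pow_eq_one, ← hiu, pow_zero]⟩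
      · exact ⟨i, Finset.mem_Icc.mpr ⟨hi0, hi.le⟩, hiu⟩
    choose s hs hsu using this
    exact ⟨s, Finset.mem_coe.mpr (Fintype.mem_piFinset.mpr hs), funext hsu⟩
  refine Finset.prod_nbij (fun s j => ε ^ s j) hmaps ?_ hsurj fun _ _ => rfl
  refine Finset.injOn_of_surjOn_of_card_le _ hmaps hsurj ?_
  rw [Fintype.card_piFinset, Fintype.card_piFinset, hε.card_nthRootsFinset]
  simp

end SymmetricProduct

/-- Comparing coefficients, `ε ^ i` fixes the `i`-th one, which therefore vanishes unless `n ∣ i`.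
-/
theorem expand_contract_of_eval_mul_left {R : Type*} [CommRing R] [Algebra R ℂ]
    [FaithfulSMul R ℂ] {n : ℕ} (hn : 0 < n) {ε : ℂ} (hε : IsPrimitiveRoot ε n) {M : R[X]}
    (h : ∀ w : ℂ, aeval (ε * w) M = aeval w M) : expand R n (contract n M) = M := by
  have hcomp : (M.map (algebraMap R ℂ)).comp (C ε * X) = M.map (algebraMap R ℂ) := by
    refine funext fun w => ?_
    simpa [eval_map_algebraMap] using h w
  ext i
  rw [coeff_expand hn]
  split_ifs with hi
  · rw [coeff_contract hn.ne', Nat.div_mul_cancel hi]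
  · have h1 := congrArg (fun p => coeff p i) hcomp
    simp only [comp_C_mul_X_coeff, coeff_map] at h1
    have h2 : algebraMap R ℂ (M.coeff i) = 0 := by
      by_contra h0
      exact hi ((hε.pow_eq_one_iff_dvd i).mp (mul_left_cancel₀ h0 (h1.trans (mul_one _).symm)))
    exact ((map_eq_zero_iff _ (FaithfulSMul.algebraMap_injective R ℂ)).mp h2).symm

/-! ### The two irreducibility results. -/

theorem irreducible_charpoly_iteratedKroneckerSum {m : ℕ} {n k x a : Fin m → ℕ}
    (hk : ∀ j, 0 < k j) (hx : ∀ j, 0 < x j) (hcop : ∀ i j, i ≠ j → Nat.Coprime (x i) (x j))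
    (hmin : ∀ j, IsLeast {N : ℕ | 0 < N ∧ ∃ b : ℕ, 0 < b ∧
      ((x j : ℝ) ^ (1 / (k j : ℝ))) ^ N = (b : ℝ)} (n j))
    (ha : ∀ j, ((x j : ℝ) ^ (1 / (k j : ℝ))) ^ n j = (a j : ℝ)) :
    Irreducible (iteratedKroneckerSum m n fun j => radicalCompanion (n j) (a j : ℚ)).charpoly := by
  set α : Fin m → ℝ := fun j => (x j : ℝ) ^ (1 / (k j : ℝ)) with hα
  have hα0 : ∀ j, 0 < α j := fun j => Real.rpow_pos_of_pos (by exact_mod_cast hx j) _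
  have hαk : ∀ j, α j ^ k j = x j := fun j => by
    simp only [hα, one_div]
    exact Real.rpow_inv_natCast_pow (Nat.cast_nonneg _) (hk j).ne'
  have hn : ∀ j, 0 < n j := fun j => (hmin j).1.1
  have hind := incommensurable_radicals (n := n) hα0 hk hαk hcop fun j N hN ⟨b, hb⟩ =>
    (hmin j).2 ⟨hN, b, by exact_mod_cast hb ▸ pow_pos (hα0 j) N, hb⟩
  have hdeg := prod_le_natDegree_minpoly_sum hα0 hn (fun j => ⟨a j, (ha j).trans (by simp)⟩) hind
  set χ := (iteratedKroneckerSum m n fun j => radicalCompanion (n j) (a j : ℚ)).charpoly with hχ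
  have hroot : aeval (∑ j, α j) χ = 0 :=
    aeval_charpoly_iteratedKroneckerSum_radicalCompanion m n _ α hn fun j => (ha j).trans (by simp)
  have hmonic : χ.Monic := Matrix.charpoly_monic _
  have hint : IsIntegral ℚ (∑ j, α j) := ⟨χ, hmonic, hroot⟩
  rw [eq_of_monic_of_dvd_of_natDegree_le (minpoly.monic hint) hmonic (minpoly.dvd _ _ hroot)
    (by rwa [hχ, Matrix.charpoly_natDegree_eq_dim, KroneckerIndex.card])]
  exact minpoly.irreducible hint

theorem exists_irreducible_nValuedProduct {m : ℕ} (hm : 0 < m) {n : ℕ} {x : Fin m → ℕ} (hn : 2 ≤ n)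
    (hx : ∀ j, 0 < x j) (hcop : ∀ i j, i ≠ j → Nat.Coprime (x i) (x j))
    (hirr : ∀ j, ∀ k : ℕ, 0 < k → k < n → Irrational (((x j : ℝ) ^ (1 / (n : ℝ))) ^ k)) :
    ∃ P : Polynomial ℤ,
      (∀ ε : ℂ, IsPrimitiveRoot ε n → ∀ z : ℂ,
        Polynomial.aeval z P = nValuedProduct n ε (fun j => (x j : ℂ)) z) ∧
      Irreducible (P.map (Int.castRingHom ℚ)) := by
  have hn0 : 0 < n := by omega
  set α : Fin m → ℝ := fun j => (x j : ℝ) ^ (1 / (n : ℝ)) with hα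
  have hα0 : ∀ j, 0 < α j := fun j => Real.rpow_pos_of_pos (by exact_mod_cast hx j) _
  have hαn : ∀ j, α j ^ n = x j := fun j => by
    simp only [hα, one_div]
    exact Real.rpow_inv_natCast_pow (Nat.cast_nonneg _) hn0.ne'
  have hind := incommensurable_radicals (n := fun _ => n) hα0 (fun _ => hn0) hαn hcop
    fun j N hN ⟨b, hb⟩ => by
      by_contra! hlt
      exact hirr j N hN hlt ⟨b, (Rat.cast_natCast b).trans hb.symm⟩
  have hprod := aeval_minpoly_neg_sum_eq_prod hα0 hn0 (fun j => ⟨x j, by simpa using hαn j⟩) hind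
  have hint : IsIntegral ℤ (-∑ j, α j) := by
    refine (IsIntegral.sum _ fun j _ => ?_).neg
    exact ⟨X ^ n - C (x j : ℤ), monic_X_pow_sub_C _ hn0.ne', by simp [hαn]⟩
  -- Since `-∑ α j` is an algebraic integer, its minimal polynomial over ℚ has integer coefficients.
  have hMQ := minpoly.isIntegrallyClosed_eq_field_fractions' ℚ hint
  have hirrQ : Irreducible (minpoly ℚ (-∑ j, α j)) := minpoly.irreducible hint.tower_top
  set M := minpoly ℤ (-∑ j, α j)
  rw [hMQ] at hprod hirrQ
  simp only [aeval_map_algebraMap] at hprod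
  have hexp : expand ℤ n (contract n M) = M :=
    expand_contract_of_eval_mul_left hn0 (Complex.isPrimitiveRoot_exp n hn0.ne') fun w => by
      rw [hprod, hprod]
      exact prod_nthRootsFinset_mul_left hn0 ⟨⟨0, hm⟩⟩
        (Complex.isPrimitiveRoot_exp n hn0.ne').pow_eq_one _ _
  refine ⟨contract n M, fun ε hε z => ?_, ?_⟩
  · have hz : (z ^ (1 / (n : ℂ))) ^ n = z := by
      rw [one_div]; exact Complex.cpow_nat_inv_pow z hn0.ne'
    have hαC : ∀ j, (x j : ℂ) ^ (1 / (n : ℂ)) = α j := fun j => by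
      rw [hα, Complex.ofReal_cpow (Nat.cast_nonneg _)]
      push_cast
      rfl
    conv_lhs => rw [← hz, ← expand_aeval, hexp, hprod]
    simp only [nValuedProduct, hαC]
    exact (prod_pow_primitiveRoot_eq_prod_nthRootsFinset hn0 hε
      fun u => z ^ (1 / (n : ℂ)) + ∑ j, u j * α j).symm
  -- A factorization of `P` would yield one of `P(w ^ n) = M(w)`.
  · refine of_irreducible_expand hn0.ne' ?_
    rw [← map_expand, hexp]
    exact hirrQ

theorem mainTheorem5 (m : ℕ) (hm : 0 < m) :
    (∀ n k x a : Fin m → ℕ,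
      (∀ j, 0 < k j) → (∀ j, 0 < x j) →
      (∀ i j, i ≠ j → Nat.Coprime (x i) (x j)) →
      (∀ j, IsLeast {N : ℕ | 0 < N ∧ ∃ b : ℕ, 0 < b ∧
        ((x j : ℝ) ^ (1 / (k j : ℝ))) ^ N = (b : ℝ)} (n j)) →
      (∀ j, ((x j : ℝ) ^ (1 / (k j : ℝ))) ^ n j = (a j : ℝ)) →
      Irreducible
        (iteratedKroneckerSum m n fun j => radicalCompanion (n j) (a j : ℚ)).charpoly) ∧
    (∀ (n : ℕ) (x : Fin m → ℕ), 2 ≤ n →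
      (∀ j, 0 < x j) →
      (∀ i j, i ≠ j → Nat.Coprime (x i) (x j)) →
      (∀ j, ∀ k : ℕ, 0 < k → k < n → Irrational (((x j : ℝ) ^ (1 / (n : ℝ))) ^ k)) →
      ∃ P : Polynomial ℤ,
        (∀ ε : ℂ, IsPrimitiveRoot ε n → ∀ z : ℂ,
          Polynomial.aeval z P = nValuedProduct n ε (fun j => (x j : ℂ)) z) ∧
        Irreducible (P.map (Int.castRingHom ℚ))) :=
  ⟨fun _ _ _ _ hk hx hcop hmin ha => irreducible_charpoly_iteratedKroneckerSum hk hx hcop hmin ha,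
    fun _ _ hn hx hcop hirr => exists_irreducible_nValuedProduct hm hn hx hcop hirr⟩
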